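/- Consider a network of $m$ parties $\mathcal A_1,\dots,\mathcal A_m$ and $n$ independent sources $\mathcal S_1,\dots,\mathcal S_n$, given by positive integers $X_i$ and $A_i$ (the numbers of inputs and outputs of party $i$) and an incidence matrix $I\in\{0,1\}^{m\times n}$, where $I_{ij}=1$ means that party $i$ is connected to source $j$. A *local model* $\mathcal M$ consists of probability spaces $(\Omega_j,\rho_j)$, $j=1,\dots,n$, and measurable response functions $P_{\mathcal A_i}(a_i\mid x_i\,\lambda_{[i]})$, which for each $x_i$ and each $\lambda_{[i]}=(\lambda_j)_{j:\,I_{ij}=1}$ form a probability distribution in $a_i\in\{1,\dots,A_i\}$. It reproduces the behavior $$P(\overline a\mid\overline x)=\int \prod_{j=1}^n \mathrm d\rho_j(\lambda_j)\ \prod_{i=1}^m P_{\mathcal A_i}(a_i\mid x_i\,\lambda_{[i]}).$$ Its *cardinality* is $\overline c=(c_1,\dots,c_n)$, with $c_j=|\Omega_j|$ if $\Omega_j$ is finite and $c_j=\infty$ otherwise. Fix a source, say $\mathcal S_1$. Let $\mathcal P_{\mathrm{AB}}$ be the set of all nonsignaling conditional probability distributions over all $m$ parties, and $\mathcal P_{\mathrm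 B}$ the set of all nonsignaling conditional probability distributions over the parties that are not connected to $\mathcal S_1$. Write $\operatorname{affdim}$ for the dimension of the affine hull. Then $$\operatorname{affdim}(\mathcal P_{\mathrm{AB}})=\prod_{i=1}^m\bigl[X_i(A_i-1)+1\bigr]-1,\qquad \operatorname{affdim}(\mathcal P_{\mathrm B})=\prod_{i:\,I_{i1}=0}\bigl[X_i(A_i-1)+1\bigr]-1.$$ Moreover, let $u_1=\operatorname{affdim}(\mathcal P_{\mathrm{AB}})-\operatorname{affdim}(\mathcal P_{\mathrm B})$. If a local model $\mathcal M$ of cardinality $(c_1,c_2,\dots,c_n)$ reproduces a behavior $P$, then there is a local model $\mathcal M'$ of cardinality $(\max(u_1,1),c_2,\dots,c_n)$ that also reproduces $P$. (Here $\max(u_1,1)=u_1$ except when no party connected to $\mathcal S_1$ has more than one output, in which case $u_1=0$.) -/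

import Mathlib

open MeasureTheory

universe u

noncomputable section

/-- A network of `m` parties and `n` sources: party `i` has the input set `Fin (X i)`, the output
set `Fin (A i)` (both nonempty), and is connected to source `j` when `inc i j = true`. -/
structure Network (m n : ℕ) where
  X : Fin m → ℕ
  A : Fin m → ℕ
  X_pos : ∀ i, 0 < X i
  A_pos : ∀ i, 0 < A i
  inc : Matrix (Fin m) (Fin n) Bool

/-- The space of tables `P(a | x)`, written `P x a`, for parties indexed by `ι` with input sets
`Fin (X i)` and output sets `Fin (A i)`. -/
abbrev Behavior {ι : Type*} (X A : ι → ℕ) : Type _ :=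
  ((i : ι) → Fin (X i)) → ((i : ι) → Fin (A i)) → ℝ

/-- The nonsignaling conditional probability distributions `P(a | x)`: for all inputs `x` it is a
probability distribution, and for each party `i` the joint distribution of the outputs of the other
parties does not depend on the input of party `i`. -/
def nonsignaling {ι : Type*} [Fintype ι] [DecidableEq ι] (X A : ι → ℕ) : Set (Behavior X A) :=
  {P | (∀ x a, 0 ≤ P x a) ∧ (∀ x, ∑ a, P x a = 1) ∧
    ∀ (i : ι) (x : (i : ι) → Fin (X i)) (xi : Fin (X i)) (a : (i : ι) → Fin (A i)),
      ∑ b : Fin (A i), P (Function.update x i xi) (Function.update a i b) =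
        ∑ b : Fin (A i), P x (Function.update a i b)}

/-- Affine dimension of a (nonempty) set: the dimension of the direction of its affine hull. -/
def affdim {E : Type*} [AddCommGroup E] [Module ℝ E] (S : Set E) : ℕ :=
  Module.finrank ℝ (vectorSpan ℝ S)

namespace Network

variable {m n : ℕ}

/-- The nonsignaling set over all parties of the network. -/
def nsAll (N : Network m n) : Set (Behavior N.X N.A) :=
  nonsignaling N.X N.A

/-- The parties that are not connected to the source `s`. -/
abbrev Unconnected (N : Network m n) (s : Fin n) : Type :=
  {i : Fin m // N.inc i s = false}

/-- The nonsignaling set over the parties that are not connected to the source `s`. -/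
def nsUnconnected (N : Network m n) (s : Fin n) :
    Set (Behavior (fun i : N.Unconnected s => N.X i) (fun i : N.Unconnected s => N.A i)) :=
  nonsignaling (fun i : N.Unconnected s => N.X i) (fun i : N.Unconnected s => N.A i)

/-- A local model in the network: every source `j` emits a value in the measurable space `Ω j`
with law `ρ j`, and every party `i` has a response function
`resp i x l a = P_i(a | x, l)`, where `l` holds the values of the sources connected to `i`. -/
structure LocalModel (N : Network m n) where
  Ω : Fin n → Type u
  mΩ : ∀ j, MeasurableSpace (Ω j)
  ρ : ∀ j, Measure (Ω j)
  prob : ∀ j, IsProbabilityMeasure (ρ j)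
  resp : ∀ i : Fin m, Fin (N.X i) → (∀ j : {j : Fin n // N.inc i j = true}, Ω j) →
    Fin (N.A i) → ℝ
  resp_nonneg : ∀ i x l a, 0 ≤ resp i x l a
  resp_sum : ∀ i x l, ∑ a, resp i x l a = 1
  resp_measurable : ∀ i x a, Measurable (fun l => resp i x l a)

namespace LocalModel

attribute [instance] LocalModel.mΩ LocalModel.prob

variable {N : Network m n}

/-- The behavior of a local model, the sources being independent. -/
def behavior (M : LocalModel N) : Behavior N.X N.A := fun x a =>
  ∫ l : (∀ j, M.Ω j), ∏ i, M.resp i (x i) (fun j => l j) (a i) ∂(Measure.pi M.ρ)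

/-- The cardinality `c_j` of source `j`: the number of elements of the value set `Ω j` if it is
finite, and `∞` otherwise. -/
def card (M : LocalModel N) (j : Fin n) : ℕ∞ := ENat.card (M.Ω j)

end LocalModel

end Network

end

/-!
Conditioning a local model on the value `ω` of the source `s` writes its behavior as an average of
behaviors in which `s` is constant and only the parties connected to `s` adapt to `ω`. All these
behaviors belong to the set `S` of behaviors obtained when the connected parties use arbitrary
responses to the remaining sources (`Network.Strategy`). Three facts about `S` give the reduction.

* The average lies in the convex hull of `S` itself, not only in its closure, since in finite
  dimension a convex set contains the mean of every distribution it carries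
  (`Convex.integral_mem_of_finiteDimensional`).
* The affine dimension of `S` is at most `u₁`, the difference of the two affine dimensions: all
  elements of `S` are nonsignaling and have the same marginal on the parties not connected to `s`,
  while every nonsignaling distribution over these parties is such a marginal
  (`Network.Strategy.affdim_range_behavior_le`).
* `S` is connected, since any two families of responses are joined by their pointwise mixtures
  (`Network.Strategy.isPreconnected_range_behavior`). Hence by the Fenchel–Bunt theorem
  (`IsPreconnected.exists_convex_combination_of_mem_convexHull`) the behavior is a mixture of
  `max u₁ 1` elements of `S`, one fewer than Carathéodory's theorem would give.

A source with `max u₁ 1` values that selects among the corresponding strategies then reproduces the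
behavior (`Network.exists_localModel_of_strategies`).

The dimension of the nonsignaling set (`affdim_nonsignaling`) comes from the marginals in which each
party is either left out or shows one of its outputs other than a fixed reference output. They
determine a nonsignaling table, which bounds the dimension of the space of these tables from above;
and there are equally many deterministic product behaviors, linearly independent because they have
a dual family of product functionals. Normalization lowers the dimension by one.
-/

noncomputable section

/-! ### Convexity in finite dimension -/

/-- A nonempty convex set in finite dimension that misses the origin lies weakly on one side of a
hyperplane through the origin. No topological assumption on the set is needed. -/
theorem Convex.exists_ne_zero_forall_nonpos {E : Type*} [NormedAddCommGroup E] [NormedSpace ℝ E]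
    [FiniteDimensional ℝ E] {S : Set E} (hS : Convex ℝ S) (hne : S.Nonempty) (h0 : (0 : E) ∉ S) :
    ∃ φ : E →L[ℝ] ℝ, φ ≠ 0 ∧ ∀ x ∈ S, φ x ≤ 0 := by
  by_cases hint : (interior S).Nonempty
  · obtain ⟨φ, hφ, h⟩ := geometric_hahn_banach_of_nonempty_interior_point hS
      (fun h => h0 (interior_subset h)) hint
    exact ⟨φ, hφ, fun x hx => by simpa using h x hx⟩
  · -- `S` lies in a proper affine subspace, on which some nonzero functional is constant.
    rw [hS.interior_nonempty_iff_affineSpan_eq_top] at hint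
    obtain ⟨x₀, hx₀⟩ := hne
    have hdir : vectorSpan ℝ S < ⊤ := by
      refine lt_top_iff_ne_top.2 fun h => hint ?_
      exact (AffineSubspace.affineSpan_eq_top_iff_vectorSpan_eq_top_of_nonempty ℝ E E
        ⟨x₀, hx₀⟩).2 h
    obtain ⟨f, hf, hker⟩ := Submodule.exists_le_ker_of_lt_top _ hdir
    have hconst : ∀ x ∈ S, f x = f x₀ := fun x hx => by
      have := hker (vsub_mem_vectorSpan ℝ hx hx₀)
      simpa [sub_eq_zero] using this
    have hne' : LinearMap.toContinuousLinearMap f ≠ 0 := fun h => hf (by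
      ext x; simpa using congrArg (fun g : E →L[ℝ] ℝ => g x) h)
    rcases le_total (f x₀) 0 with h | h
    · exact ⟨LinearMap.toContinuousLinearMap f, hne', fun x hx => by simpa [hconst x hx] using h⟩
    · exact ⟨-LinearMap.toContinuousLinearMap f, neg_ne_zero.2 hne',
        fun x hx => by simpa [hconst x hx] using h⟩

/-- The induction on the dimension behind `Convex.integral_mem_of_finiteDimensional`: if the mean
`0` were missed by `S`, a supporting functional `φ` would have mean `0` and constant sign, so the
distribution would live on `ker φ`, of smaller dimension. -/
theorem Convex.zero_mem_of_integral_eq_zero {Λ : Type*} [MeasurableSpace Λ] (μ : Measure Λ)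
    [IsProbabilityMeasure μ] (d : ℕ) :
    ∀ {E : Type u} [NormedAddCommGroup E] [NormedSpace ℝ E] [FiniteDimensional ℝ E],
      Module.finrank ℝ E = d → ∀ {S : Set E}, Convex ℝ S → ∀ {f : Λ → E}, Integrable f μ →
      (∀ᵐ ω ∂μ, f ω ∈ S) → ∫ ω, f ω ∂μ = 0 → (0 : E) ∈ S := by
  induction d using Nat.strong_induction_on with
  | _ d ih =>
    intro E _ _ _ hd S hS f hf hfS hmean
    by_contra h0
    obtain ⟨ω₀, hω₀⟩ := hfS.exists
    obtain ⟨φ, hφ, hle⟩ := hS.exists_ne_zero_forall_nonpos ⟨_, hω₀⟩ h0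
    have hint : ∫ ω, -φ (f ω) ∂μ = 0 := by
      rw [integral_neg, φ.integral_comp_comm hf, hmean, map_zero, neg_zero]
    have hae : (fun ω => -φ (f ω)) =ᵐ[μ] 0 := by
      refine (integral_eq_zero_iff_of_nonneg_ae ?_ (φ.integrable_comp hf).neg).1 hint
      filter_upwards [hfS] with ω hω
      simpa using hle _ hω
    set K : Submodule ℝ E := LinearMap.ker (φ : E →ₗ[ℝ] ℝ) with hK
    have hKlt : Module.finrank ℝ K < d := by
      rw [← hd]
      refine Submodule.finrank_lt fun h => hφ ?_
      ext x
      have : x ∈ K := h ▸ Submodule.mem_top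
      simpa [hK] using this
    obtain ⟨p, hp⟩ := LinearMap.exists_leftInverse_of_injective K.subtype K.ker_subtype
    have hpK : ∀ v : K, p (v : E) = v := fun v => LinearMap.congr_fun hp v
    set q : E →L[ℝ] K := LinearMap.toContinuousLinearMap p
    have hmem := ih _ hKlt (E := K) rfl (S := K.subtype ⁻¹' S) (hS.linear_preimage _)
      (f := fun ω => q (f ω)) (q.integrable_comp hf) (by
        filter_upwards [hfS, hae] with ω hω hz
        have hk : f ω ∈ K := by simpa [hK] using hz
        have : ((q (f ω) : K) : E) = f ω := congrArg Subtype.val (hpK ⟨f ω, hk⟩)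
        simpa [this] using hω)
      (by rw [q.integral_comp_comm hf, hmean, map_zero])
    exact h0 (by simpa using hmem)

/-- In finite dimension, the mean of a probability distribution carried by a convex set lies in the
set itself; in contrast with `Convex.integral_mem`, the set need not be closed. -/
theorem Convex.integral_mem_of_finiteDimensional {Λ : Type*} [MeasurableSpace Λ] {μ : Measure Λ}
    [IsProbabilityMeasure μ] {E : Type*} [NormedAddCommGroup E] [NormedSpace ℝ E]
    [FiniteDimensional ℝ E] {S : Set E} (hS : Convex ℝ S) {f : Λ → E} (hf : Integrable f μ)
    (hfS : ∀ᵐ ω ∂μ, f ω ∈ S) : ∫ ω, f ω ∂μ ∈ S := by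
  set m := ∫ ω, f ω ∂μ
  have h := Convex.zero_mem_of_integral_eq_zero μ _ rfl (S := (fun z => m + z) ⁻¹' S)
    (hS.translate_preimage_right m) (f := fun ω => f ω - m) (hf.sub (integrable_const _))
    (by filter_upwards [hfS] with ω hω; simpa using hω)
    (by rw [integral_sub hf (integrable_const _)]; simp [m])
  simpa using h

/-- The exchange step of the Fenchel–Bunt theorem. If `p` is a convex combination with positive
weights of `d + 1` affinely independent points of a connected set `S` of dimension `d ≥ 1`, then
some point of `S` can replace two of them. -/
theorem IsPreconnected.exists_exchange {E : Type*} [NormedAddCommGroup E] [NormedSpace ℝ E]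
    [FiniteDimensional ℝ E] {S : Set E} (hS : IsPreconnected S) {ι : Type*} [Fintype ι]
    [DecidableEq ι] {z : ι → E} (hz : ∀ i, z i ∈ S) (hind : AffineIndependent ℝ z)
    (hcard : Fintype.card ι = Module.finrank ℝ (vectorSpan ℝ S) + 1)
    {w : ι → ℝ} (hw : ∀ i, 0 < w i) (hw1 : ∑ i, w i = 1) (i₀ : ι) (hι : ∃ i, i ≠ i₀) :
    ∃ (y : {i // i ≠ i₀} → E) (v : {i // i ≠ i₀} → ℝ), (∀ i, y i ∈ S) ∧ (∀ i, 0 ≤ v i) ∧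
      ∑ i, v i = 1 ∧ ∑ i, v i • y i = ∑ i, w i • z i := by
  have hspan : Submodule.span ℝ (Set.range fun i : {i // i ≠ i₀} => z i - z i₀) =
      vectorSpan ℝ S := by
    rw [← hind.vectorSpan_eq_of_le_of_card_eq_finrank_add_one
      (vectorSpan_mono ℝ (Set.range_subset_iff.2 hz)) hcard,
      vectorSpan_range_eq_span_range_vsub_right_ne ℝ z i₀]
    rfl
  have hlin : LinearIndependent ℝ fun i : {i // i ≠ i₀} => z i - z i₀ :=
    (affineIndependent_iff_linearIndependent_vsub ℝ z i₀).1 hind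
  -- `c` reads off the barycentric coordinates with respect to the points `z i`, `i ≠ i₀`.
  obtain ⟨g, hg⟩ := LinearMap.exists_leftInverse_of_injective
    (Fintype.linearCombination ℝ fun i : {i // i ≠ i₀} => z i - z i₀)
    (LinearMap.ker_eq_bot.2 hlin.fintypeLinearCombination_injective)
  set c : {i // i ≠ i₀} → E → ℝ := fun i s => g (s - z i₀) i with hc
  set c₀ : E → ℝ := fun s => 1 - ∑ i, c i s with hc₀
  have hgc : Continuous g := g.continuous_of_finiteDimensional
  have hcc : ∀ i, Continuous (c i) := fun i => by
    exact (continuous_apply i).comp (hgc.comp (continuous_id.sub continuous_const))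
  have hcc₀ : Continuous c₀ := continuous_const.sub (continuous_finsetSum _ fun i _ => hcc i)
  have hrep : ∀ s ∈ S, s - z i₀ = ∑ i, c i s • (z i - z i₀) := by
    intro s hs
    have hmem : s - z i₀ ∈ Submodule.span ℝ (Set.range fun i : {i // i ≠ i₀} => z i - z i₀) := by
      rw [hspan]; exact vsub_mem_vectorSpan ℝ hs (hz i₀)
    rw [← Fintype.range_linearCombination] at hmem
    obtain ⟨b, hb⟩ := hmem
    have hgb : g (s - z i₀) = b := by rw [← hb]; exact LinearMap.congr_fun hg b
    simp only [hc, hgb]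
    rw [← hb, Fintype.linearCombination_apply]
  have hcz : ∀ i j : {i // i ≠ i₀}, c i (z j) = if i = j then 1 else 0 := by
    intro i j
    have : g (z j - z i₀) = Pi.single j 1 := by
      have := LinearMap.congr_fun hg (Pi.single j 1)
      simpa [Fintype.linearCombination_apply_single] using this
    simp only [hc, this, Pi.single_apply]
  have hcz₀ : ∀ i, c i (z i₀) = 0 := fun i => by simp [hc]
  obtain ⟨i₂, hi₂⟩ := hι
  have hne : (Finset.univ : Finset {i // i ≠ i₀}).Nonempty := ⟨⟨i₂, hi₂⟩, Finset.mem_univ _⟩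
  -- At a zero of `h` the largest ratio of coordinate to weight is attained twice.
  set h : E → ℝ := fun s => c₀ s / w i₀ - Finset.univ.sup' hne (fun i => c i s / w i) with hh
  have hcont : Continuous h := (hcc₀.div_const _).sub
    (Continuous.finset_sup'_apply hne fun i _ => (hcc i).div_const _)
  have h₂ : h (z i₂) ≤ 0 := by
    have h1 : c₀ (z i₂) = 0 := by
      have := fun i => hcz i ⟨i₂, hi₂⟩
      simp only at this
      simp [hc₀, this]
    have h2 : c ⟨i₂, hi₂⟩ (z i₂) / w i₂ ≤
        Finset.univ.sup' hne (fun i : {i // i ≠ i₀} => c i (z i₂) / w i) :=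
      Finset.le_sup' (fun i : {i // i ≠ i₀} => c i (z i₂) / w i) (Finset.mem_univ ⟨i₂, hi₂⟩)
    have h3 : c ⟨i₂, hi₂⟩ (z i₂) = 1 := by
      have := hcz ⟨i₂, hi₂⟩ ⟨i₂, hi₂⟩
      simpa using this
    have h4 : 0 < 1 / w i₂ := one_div_pos.2 (hw _)
    rw [h3] at h2
    simp only [hh, h1, zero_div]
    linarith
  have h₀ : 0 ≤ h (z i₀) := by
    have h1 : 0 < 1 / w i₀ := one_div_pos.2 (hw _)
    simp only [hh, hc₀, hcz₀, zero_div, Finset.sup'_const, Finset.sum_const_zero, sub_zero]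
    exact h1.le
  obtain ⟨s, hs, hs0⟩ := hS.intermediate_value (hz i₂) (hz i₀) hcont.continuousOn ⟨h₂, h₀⟩
  obtain ⟨i₁, -, hi₁⟩ := Finset.exists_mem_eq_sup' hne (fun i => c i s / w i)
  set M := c₀ s / w i₀ with hM
  have hMsup : Finset.univ.sup' hne (fun i => c i s / w i) = M := by
    simp only [hh] at hs0; linarith
  have hMi : ∀ i, c i s ≤ M * w i := fun i => by
    rw [← div_le_iff₀ (hw _), ← hMsup]
    exact Finset.le_sup' (fun i => c i s / w i) (Finset.mem_univ i)
  have hM₁ : c i₁ s = M * w i₁ := by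
    rw [← div_eq_iff (hw _).ne', ← hi₁, hMsup]
  have hM₀ : c₀ s = M * w i₀ := by rw [hM, div_mul_cancel₀ _ (hw _).ne']
  have hsumw : w i₀ + ∑ i : {i // i ≠ i₀}, w i = 1 := by
    rw [← hw1, Fintype.sum_eq_add_sum_subtype_ne w i₀]
  have hM1 : 1 ≤ M := by
    have : ∑ i, c i s ≤ M * ∑ i : {i // i ≠ i₀}, w i := by
      rw [Finset.mul_sum]; exact Finset.sum_le_sum fun i _ => hMi i
    have h5 : c₀ s + ∑ i, c i s = 1 := by simp [hc₀]
    nlinarith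
  have hMpos : 0 < M := by linarith
  have hθ : ∀ i : {i // i ≠ i₀}, 0 ≤ w i - M⁻¹ * c i s := fun i => by
    have := mul_le_mul_of_nonneg_left (hMi i) (inv_nonneg.2 hMpos.le)
    rw [inv_mul_cancel_left₀ hMpos.ne'] at this
    linarith
  have hθ₁ : w i₁ - M⁻¹ * c i₁ s = 0 := by
    rw [hM₁, inv_mul_cancel_left₀ hMpos.ne', sub_self]
  have hθ₀ : w i₀ = M⁻¹ * (1 - ∑ i, c i s) := by
    change w i₀ = M⁻¹ * c₀ s
    rw [hM₀, inv_mul_cancel_left₀ hMpos.ne']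
  refine ⟨fun i => if i = i₁ then s else z i,
    fun i => (w i - M⁻¹ * c i s) + if i = i₁ then M⁻¹ else 0, fun i => ?_, fun i => ?_, ?_, ?_⟩
  · dsimp only
    split_ifs
    exacts [hs, hz i]
  · have := hθ i
    have : 0 ≤ M⁻¹ := inv_nonneg.2 hMpos.le
    dsimp only
    split_ifs <;> linarith
  · rw [Finset.sum_add_distrib, Finset.sum_sub_distrib, ← Finset.mul_sum, Finset.sum_ite_eq',
      if_pos (Finset.mem_univ _)]
    linarith
  · have hterm : ∀ i : {i // i ≠ i₀}, ((w i - M⁻¹ * c i s) + if i = i₁ then M⁻¹ else 0) •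
        (if i = i₁ then s else z i) =
        (w i - M⁻¹ * c i s) • z i + if i = i₁ then M⁻¹ • s else 0 := by
      intro i
      by_cases hi : i = i₁
      · subst hi; simp [hθ₁]
      · simp [hi]
    simp only [hterm]
    rw [Finset.sum_add_distrib, Finset.sum_ite_eq', if_pos (Finset.mem_univ _),
      Fintype.sum_eq_add_sum_subtype_ne (fun i => w i • z i) i₀]
    have hs' : s = z i₀ + ∑ i, c i s • (z i - z i₀) := by rw [← hrep s hs]; abel
    have e : M⁻¹ • s = w i₀ • z i₀ + ∑ i : {i // i ≠ i₀}, (M⁻¹ * c i s) • z i := by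
      conv_lhs => rw [hs']
      simp only [smul_sub, Finset.sum_sub_distrib, ← Finset.sum_smul]
      rw [hθ₀, smul_add, smul_sub, Finset.smul_sum]
      simp only [smul_smul, mul_sub, sub_smul, mul_one]
      abel
    rw [e]
    simp only [sub_smul, Finset.sum_sub_distrib]
    abel

/-- Every convex combination indexed by at most `c` points can be indexed by `Fin c`, the additional
points having weight zero. -/
theorem exists_fin_convex_combination {E : Type*} [AddCommGroup E] [Module ℝ E] {S : Set E}
    {ι : Type*} [Fintype ι] {y : ι → E} {v : ι → ℝ} (hy : ∀ i, y i ∈ S) (hv : ∀ i, 0 ≤ v i)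
    (hv1 : ∑ i, v i = 1) {c : ℕ} (hc : Fintype.card ι ≤ c) :
    ∃ (z : Fin c → E) (w : Fin c → ℝ), (∀ k, z k ∈ S) ∧ (∀ k, 0 ≤ w k) ∧ ∑ k, w k = 1 ∧
      ∑ k, w k • z k = ∑ i, v i • y i := by
  have hne : Nonempty ι := by
    by_contra h
    rw [not_nonempty_iff] at h
    simp at hv1
  obtain ⟨i₀⟩ := hne
  obtain ⟨e⟩ := Function.Embedding.nonempty_of_card_le (β := Fin c) (by simpa using hc)
  refine ⟨Function.extend e y fun _ => y i₀, Function.extend e v 0, fun k => ?_, fun k => ?_,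
    ?_, ?_⟩
  · by_cases h : ∃ i, e i = k
    · obtain ⟨i, rfl⟩ := h
      rw [e.injective.extend_apply]; exact hy i
    · rw [Function.extend_apply' _ _ _ h]; exact hy i₀
  · by_cases h : ∃ i, e i = k
    · obtain ⟨i, rfl⟩ := h
      rw [e.injective.extend_apply]; exact hv i
    · rw [Function.extend_apply' _ _ _ h]; rfl
  · rw [← hv1]
    refine (Fintype.sum_of_injective e e.injective _ _ (fun k hk => ?_) fun i => ?_).symm
    · rw [Function.extend_apply' _ _ _ (by simpa using hk)]; rfl
    · rw [e.injective.extend_apply]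
  · refine (Fintype.sum_of_injective e e.injective _ _ (fun k hk => ?_) fun i => ?_).symm
    · rw [Function.extend_apply' v _ _ (by simpa using hk)]; exact zero_smul _ _
    · rw [e.injective.extend_apply, e.injective.extend_apply]

/-- **Fenchel–Bunt theorem**: for a connected set of affine dimension at most `c`, with `c ≥ 1`,
every point of the convex hull is a convex combination of `c` points, one fewer than in
Carathéodory's theorem. -/
theorem IsPreconnected.exists_convex_combination_of_mem_convexHull {E : Type*}
    [NormedAddCommGroup E] [NormedSpace ℝ E] [FiniteDimensional ℝ E] {S : Set E}
    (hS : IsPreconnected S) {c : ℕ} (hdim : Module.finrank ℝ (vectorSpan ℝ S) ≤ c) (hc : 1 ≤ c)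
    {p : E} (hp : p ∈ convexHull ℝ S) :
    ∃ (z : Fin c → E) (w : Fin c → ℝ), (∀ k, z k ∈ S) ∧ (∀ k, 0 ≤ w k) ∧ ∑ k, w k = 1 ∧
      ∑ k, w k • z k = p := by
  classical
  obtain ⟨ι, _, z, w, hz, hind, hw, hw1, rfl⟩ := eq_pos_convex_span_of_mem_convexHull hp
  rw [Set.range_subset_iff] at hz
  by_cases hle : Fintype.card ι ≤ c
  · exact exists_fin_convex_combination hz (fun i => (hw i).le) hw1 hle
  · have h1 := hind.card_le_finrank_succ
    have h2 : Module.finrank ℝ (vectorSpan ℝ (Set.range z)) ≤ Module.finrank ℝ (vectorSpan ℝ S) :=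
      Submodule.finrank_mono (vectorSpan_mono ℝ (Set.range_subset_iff.2 hz))
    have : Nontrivial ι := Fintype.one_lt_card_iff_nontrivial.1 (by lia)
    obtain ⟨i₀⟩ : Nonempty ι := inferInstance
    obtain ⟨y, v, hy, hv, hv1, hvy⟩ := hS.exists_exchange hz hind (by lia) hw hw1 i₀
      (exists_ne i₀)
    rw [← hvy]
    refine exists_fin_convex_combination hy hv hv1 ?_
    rw [Fintype.card_subtype_compl, Fintype.card_subtype_eq]
    lia

section Nonsignaling

variable {ι : Type*} {X A : ι → ℕ}

/-! ### Deterministic responses and their dual functionals -/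

/-- The marginal that leaves party `i` out is indexed by `none`, and the one with input `x` and
output `a`, which differs from the reference output `o i`, by `some (x, a)`. -/
abbrev MarginalIndex (X : ι → ℕ) {A : ι → ℕ} (o : ∀ i, Fin (A i)) (i : ι) : Type :=
  Option (Fin (X i) × {a : Fin (A i) // a ≠ o i})

/-- The deterministic response labelled by a marginal: `none` always answers the reference output,
and `some (x, a)` answers `a` to the input `x` and the reference output to all others. -/
def MarginalIndex.response (o : ∀ i, Fin (A i)) {i : ι} :
    MarginalIndex X o i → Fin (X i) → Fin (A i)
  | none, _ => o i
  | some (x', a'), x => if x = x' then a' else o i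

/-- The weights of the functional dual to the deterministic responses. -/
def MarginalIndex.dualWeight (x₀ : ∀ i, Fin (X i)) (o : ∀ i, Fin (A i)) {i : ι} :
    MarginalIndex X o i → Fin (X i) → Fin (A i) → ℝ
  | none, x, a => (if x = x₀ i then 1 else 0) - if a = o i then 0 else 1
  | some (x', a'), x, a => if x = x' then (if a = a' then 1 else 0) else 0

theorem MarginalIndex.sum_dualWeight_response (x₀ : ∀ i, Fin (X i)) (o : ∀ i, Fin (A i)) {i : ι}
    (t t' : MarginalIndex X o i) :
    ∑ x, MarginalIndex.dualWeight x₀ o t x (MarginalIndex.response o t' x) =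
      if t = t' then 1 else 0 := by
  rcases t with _ | ⟨x, a⟩ <;> rcases t' with _ | ⟨x', a'⟩
  · simp [dualWeight, response]
  · have : ∀ y, dualWeight x₀ o (none : MarginalIndex X o i) y (response o (some (x', a')) y) =
        (if y = x₀ i then 1 else 0) - if y = x' then 1 else 0 := by
      intro y
      by_cases hy : y = x' <;> simp [dualWeight, response, hy, a'.2]
    simp [this]
  · simp [dualWeight, response, a.2.symm]
  · by_cases hx : x = x'
    · subst hx
      simp [dualWeight, response, Subtype.ext_iff, eq_comm]
    · simp [dualWeight, response, hx, a.2.symm]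

variable [Fintype ι] [DecidableEq ι]

/-! ### Product distributions are nonsignaling -/

/-- Changing the input of party `i` does not affect the others in a product distribution. -/
theorem sum_update_prod (f : ∀ i, Fin (X i) → Fin (A i) → ℝ) (hf : ∀ i x, ∑ a, f i x a = 1)
    (i : ι) (x : ∀ i, Fin (X i)) (xi : Fin (X i)) (a : ∀ i, Fin (A i)) :
    ∑ b, ∏ j, f j (Function.update x i xi j) (Function.update a i b j) =
      ∏ j ∈ Finset.univ.erase i, f j (x j) (a j) := by
  have h : ∀ b, ∏ j, f j (Function.update x i xi j) (Function.update a i b j) =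
      f i xi b * ∏ j ∈ Finset.univ.erase i, f j (x j) (a j) := by
    intro b
    rw [← Finset.mul_prod_erase _ _ (Finset.mem_univ i)]
    congr 1
    · simp
    · refine Finset.prod_congr rfl fun j hj => ?_
      rw [Function.update_of_ne (Finset.ne_of_mem_erase hj),
        Function.update_of_ne (Finset.ne_of_mem_erase hj)]
  simp only [h]
  rw [← Finset.sum_mul, hf, one_mul]

theorem prod_mem_nonsignaling (f : ∀ i, Fin (X i) → Fin (A i) → ℝ) (hf0 : ∀ i x a, 0 ≤ f i x a)
    (hf : ∀ i x, ∑ a, f i x a = 1) :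
    (fun x a => ∏ i, f i (x i) (a i) : Behavior X A) ∈ nonsignaling X A := by
  refine ⟨fun x a => Finset.prod_nonneg fun i _ => hf0 _ _ _, fun x => ?_, fun i x xi a => ?_⟩
  · rw [← Fintype.prod_sum fun i => f i (x i)]
    exact Finset.prod_eq_one fun i _ => hf _ _
  · have := sum_update_prod f hf i x (x i) a
    rw [Function.update_eq_self] at this
    rw [sum_update_prod f hf, this]

/-! ### Marginals determine a nonsignaling behavior -/

/-- The linear space of all tables, of any sign and normalization, that satisfy the no-signaling
equations. -/
def nonsignalingSpace (X A : ι → ℕ) : Submodule ℝ (Behavior X A) where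
  carrier := {P | ∀ (i : ι) (x : (i : ι) → Fin (X i)) (xi : Fin (X i)) (a : (i : ι) → Fin (A i)),
      ∑ b : Fin (A i), P (Function.update x i xi) (Function.update a i b) =
        ∑ b : Fin (A i), P x (Function.update a i b)}
  add_mem' hP hQ i x xi a := by
    simp only [Pi.add_apply, Finset.sum_add_distrib, hP i x xi a, hQ i x xi a]
  zero_mem' i x xi a := by simp
  smul_mem' r P hP i x xi a := by
    simp only [Pi.smul_apply, ← Finset.smul_sum, hP i x xi a]

/-- The marginal `P(u | x)`: the output of party `i` is prescribed when `u i = some b` and summed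
over when `u i = none`. -/
def marginal (x : ∀ i, Fin (X i)) (u : ∀ i, Option (Fin (A i))) : Behavior X A →ₗ[ℝ] ℝ where
  toFun P := ∑ a, if ∀ i, u i = none ∨ u i = some (a i) then P x a else 0
  map_add' P Q := by
    rw [← Finset.sum_add_distrib]
    refine Finset.sum_congr rfl fun a _ => ?_
    split_ifs <;> simp
  map_smul' r P := by
    rw [RingHom.id_apply, Finset.smul_sum]
    refine Finset.sum_congr rfl fun a _ => ?_
    split_ifs <;> simp

theorem marginal_apply (x : ∀ i, Fin (X i)) (u : ∀ i, Option (Fin (A i))) (P : Behavior X A) :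
    marginal x u P = ∑ a, if ∀ i, u i = none ∨ u i = some (a i) then P x a else 0 := rfl

theorem marginal_some (x : ∀ i, Fin (X i)) (a : ∀ i, Fin (A i)) (P : Behavior X A) :
    marginal x (fun i => some (a i)) P = P x a := by
  rw [marginal_apply, Finset.sum_eq_single a]
  · simp
  · intro b _ hb
    rw [if_neg]
    intro h
    exact hb (funext fun i => by simpa [eq_comm] using h i)
  · simp

theorem marginal_none (x : ∀ i, Fin (X i)) (P : Behavior X A) :
    marginal x (fun _ => none) P = ∑ a, P x a := by
  simp [marginal_apply]

/-- Summing over one coordinate twice multiplies the total by the number of its values. -/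
theorem sum_sum_update {κ : ι → Type*} [∀ i, Fintype (κ i)] (i : ι) (F : (∀ i, κ i) → ℝ) :
    ∑ a, ∑ b, F (Function.update a i b) = Fintype.card (κ i) * ∑ a, F a := by
  -- `(a, b) ↦ (update a i b, a i)` is an involution.
  have h : ∑ p : (∀ i, κ i) × κ i, F (Function.update p.1 i p.2) =
      ∑ p : (∀ i, κ i) × κ i, F p.1 := by
    refine Finset.sum_nbij' (fun p => (Function.update p.1 i p.2, p.1 i))
      (fun p => (Function.update p.1 i p.2, p.1 i)) ?_ ?_ ?_ ?_ ?_ <;> simp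
  rw [Fintype.sum_prod_type, Fintype.sum_prod_type] at h
  rw [h]
  simp [Finset.mul_sum]

theorem marginal_update_input {P : Behavior X A} (hP : P ∈ nonsignalingSpace X A) (i : ι)
    (x : ∀ i, Fin (X i)) (xi : Fin (X i)) {u : ∀ i, Option (Fin (A i))} (hu : u i = none) :
    marginal (Function.update x i xi) u P = marginal x u P := by
  by_cases hA : IsEmpty (Fin (A i))
  · have : IsEmpty (∀ i, Fin (A i)) := ⟨fun a => hA.false (a i)⟩
    simp [marginal_apply]
  have hcard : (Fintype.card (Fin (A i)) : ℝ) ≠ 0 := by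
    rw [not_isEmpty_iff] at hA
    exact_mod_cast Fintype.card_ne_zero
  have hc : ∀ (a : ∀ i, Fin (A i)) (b : Fin (A i)),
      (∀ j, u j = none ∨ u j = some (Function.update a i b j)) ↔
        ∀ j, u j = none ∨ u j = some (a j) := by
    intro a b
    refine forall_congr' fun j => ?_
    rcases eq_or_ne j i with rfl | hj
    · simp [hu]
    · rw [Function.update_of_ne hj]
  have key : ∀ y : ∀ i, Fin (X i), Fintype.card (Fin (A i)) * marginal y u P =
      ∑ a, if ∀ j, u j = none ∨ u j = some (a j) then
        ∑ b, P y (Function.update a i b) else 0 := by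
    intro y
    rw [marginal_apply, ← sum_sum_update i
      fun a => if ∀ j, u j = none ∨ u j = some (a j) then P y a else 0]
    refine Finset.sum_congr rfl fun a _ => ?_
    simp only [hc]
    split_ifs <;> simp
  refine mul_left_cancel₀ hcard ?_
  rw [key, key]
  simp only [hP i x xi]

theorem marginal_congr_input {P : Behavior X A} (hP : P ∈ nonsignalingSpace X A)
    {x y : ∀ i, Fin (X i)} {u : ∀ i, Option (Fin (A i))} (h : ∀ i, u i ≠ none → x i = y i) :
    marginal x u P = marginal y u P := by
  have key : ∀ s : Finset ι, (∀ i ∈ s, u i = none) →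
      marginal (s.piecewise y x) u P = marginal x u P := by
    intro s
    induction s using Finset.induction_on with
    | empty => intro _; rw [Finset.piecewise_empty]
    | insert i s _ ih =>
      intro hs
      rw [Finset.piecewise_insert, marginal_update_input hP i _ _ (hs i (s.mem_insert_self i))]
      exact ih fun j hj => hs j (Finset.mem_insert_of_mem hj)
  rw [← key (Finset.univ.filter fun i => u i = none) (by simp)]
  congr 2
  funext i
  by_cases hi : u i = none <;> simp [Finset.piecewise, hi, h]

/-- Summing over the output of party `i` removes it from the marginal. -/
theorem marginal_update_none (P : Behavior X A) (x : ∀ i, Fin (X i))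
    (u : ∀ i, Option (Fin (A i))) (i : ι) :
    marginal x (Function.update u i none) P =
      ∑ b, marginal x (Function.update u i (some b)) P := by
  simp only [marginal_apply]
  rw [Finset.sum_comm]
  refine Finset.sum_congr rfl fun a _ => ?_
  have hc : ∀ b, (∀ j, Function.update u i (some b) j = none ∨
      Function.update u i (some b) j = some (a j)) ↔
        b = a i ∧ ∀ j, Function.update u i none j = none ∨
          Function.update u i none j = some (a j) := by
    intro b
    constructor
    · intro h
      refine ⟨by simpa using h i, fun j => ?_⟩
      rcases eq_or_ne j i with rfl | hj
      · simp
      · simpa [hj] using h j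
    · rintro ⟨rfl, h⟩ j
      rcases eq_or_ne j i with rfl | hj
      · simp
      · simpa [hj] using h j
  simp only [hc, ite_and, Finset.sum_ite_eq', Finset.mem_univ, if_true]

/-- A nonsignaling table vanishes as soon as all its marginals avoiding a reference output `o i` of
each party do: normalization recovers the probability of `o i` from those of the other outputs and
from the marginal without party `i`. -/
theorem eq_zero_of_marginal_eq_zero (o : ∀ i, Fin (A i)) {P : Behavior X A}
    (h : ∀ x (u : ∀ i, Option (Fin (A i))), (∀ i, u i ≠ some (o i)) → marginal x u P = 0) :
    P = 0 := by
  have key : ∀ (k : ℕ) x (u : ∀ i, Option (Fin (A i))),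
      (Finset.univ.filter fun i => u i = some (o i)).card = k → marginal x u P = 0 := by
    intro k
    induction k with
    | zero =>
      intro x u hu
      refine h x u fun i hi => ?_
      rw [Finset.card_eq_zero, Finset.filter_eq_empty_iff] at hu
      exact hu (Finset.mem_univ i) hi
    | succ k ih =>
      intro x u hu
      obtain ⟨i, hi⟩ : (Finset.univ.filter fun i => u i = some (o i)).Nonempty := by
        rw [← Finset.card_pos]; lia
      have hui : u i = some (o i) := by simpa using hi
      have hlow : ∀ v : Option (Fin (A i)), v ≠ some (o i) →
          marginal x (Function.update u i v) P = 0 := by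
        intro v hv
        refine ih x _ ?_
        have : (Finset.univ.filter fun j => Function.update u i v j = some (o j)) =
            (Finset.univ.filter fun j => u j = some (o j)).erase i := by
          ext j
          rcases eq_or_ne j i with rfl | hj
          · simp [hv]
          · simp [hj]
        rw [this, Finset.card_erase_of_mem hi, hu, Nat.add_sub_cancel]
      have hsum := marginal_update_none P x u i
      rw [hlow none (by simp), Finset.sum_eq_single (o i)] at hsum
      · rw [← hui, Function.update_eq_self] at hsum
        exact hsum.symm
      · intro b _ hb
        exact hlow _ (by simpa using hb)
      · simp
  funext x a
  rw [← marginal_some x a P, key _ x _ rfl]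
  rfl

/-! ### The dimension of the nonsignaling set -/

theorem card_marginalIndex (o : ∀ i, Fin (A i)) :
    (Fintype.card (∀ i, MarginalIndex X o i) : ℤ) =
      ∏ i, ((X i : ℤ) * ((A i : ℤ) - 1) + 1) := by
  rw [Fintype.card_pi, Nat.cast_prod]
  refine Finset.prod_congr rfl fun i _ => ?_
  have : 0 < A i := (o i).pos
  rw [Fintype.card_option, Fintype.card_prod, Fintype.card_subtype_compl,
    Fintype.card_subtype_eq, Fintype.card_fin, Fintype.card_fin]
  push_cast [Nat.cast_sub this]
  ring

theorem finrank_nonsignalingSpace_le (x₀ : ∀ i, Fin (X i)) (o : ∀ i, Fin (A i)) :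
    Module.finrank ℝ (nonsignalingSpace X A) ≤ Fintype.card (∀ i, MarginalIndex X o i) := by
  let Ψ : Behavior X A →ₗ[ℝ] ((∀ i, MarginalIndex X o i) → ℝ) := LinearMap.pi fun t =>
    marginal (fun i => ((t i).map Prod.fst).getD (x₀ i)) fun i => (t i).map fun p => p.2.1
  have hinj : Function.Injective (Ψ.comp (nonsignalingSpace X A).subtype) := by
    rw [← LinearMap.ker_eq_bot, LinearMap.ker_eq_bot']
    intro P hP
    refine Subtype.ext (eq_zero_of_marginal_eq_zero o fun x u hu => ?_)
    have hex : ∀ i, ∃ t : MarginalIndex X o i, t.map (fun p => p.2.1) = u i ∧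
        (u i ≠ none → x i = (t.map Prod.fst).getD (x₀ i)) := by
      intro i
      rcases hui : u i with _ | b
      · exact ⟨none, rfl, fun h => absurd rfl h⟩
      · exact ⟨some (x i, ⟨b, fun hb => hu i (by rw [hui, hb])⟩), rfl, fun _ => rfl⟩
    choose t hut hxt using hex
    have ht : marginal (fun i => ((t i).map Prod.fst).getD (x₀ i))
      (fun i => (t i).map fun p => p.2.1) P.1 = 0 := congrFun hP t
    rwa [funext hut, ← marginal_congr_input P.2 hxt] at ht
  simpa using LinearMap.finrank_le_finrank_of_injective hinj

/-- The deterministic product behavior labelled by a family of marginals. -/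
def deterministicBehavior (o : ∀ i, Fin (A i)) (t : ∀ i, MarginalIndex X o i) : Behavior X A :=
  fun x a => ∏ i, if a i = MarginalIndex.response o (t i) (x i) then 1 else 0

theorem deterministicBehavior_mem (o : ∀ i, Fin (A i)) (t : ∀ i, MarginalIndex X o i) :
    deterministicBehavior o t ∈ nonsignaling X A := by
  refine prod_mem_nonsignaling
    (fun i x a => if a = MarginalIndex.response o (t i) x then 1 else 0) (fun i x a => ?_)
    fun i x => ?_
  · split_ifs <;> norm_num
  · simp

theorem linearIndependent_deterministicBehavior (x₀ : ∀ i, Fin (X i)) (o : ∀ i, Fin (A i)) :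
    LinearIndependent ℝ (deterministicBehavior (X := X) o) := by
  -- the product functionals dual to the deterministic behaviors
  let φ : Behavior X A →ₗ[ℝ] ((∀ i, MarginalIndex X o i) → ℝ) := LinearMap.pi fun t =>
    { toFun := fun P => ∑ x, ∑ a,
        P x a * ∏ i, MarginalIndex.dualWeight x₀ o (t i) (x i) (a i)
      map_add' := fun P Q => by
        simp only [Pi.add_apply, add_mul, Finset.sum_add_distrib]
      map_smul' := fun r P => by
        simp only [Pi.smul_apply, smul_eq_mul, mul_assoc, Finset.mul_sum, RingHom.id_apply] }
  refine LinearIndependent.of_comp φ ?_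
  convert! (Pi.basisFun ℝ (∀ i, MarginalIndex X o i)).linearIndependent
  funext t' t
  have h : φ (deterministicBehavior o t') t = ∏ i, ∑ x, ∑ a,
      (if a = MarginalIndex.response o (t' i) x then 1 else 0) *
        MarginalIndex.dualWeight x₀ o (t i) x a := by
    rw [Fintype.prod_sum]
    refine Finset.sum_congr rfl fun x _ => ?_
    rw [Fintype.prod_sum]
    refine Finset.sum_congr rfl fun a _ => ?_
    rw [Finset.prod_mul_distrib]
    rfl
  simp only [Function.comp_apply, h, ite_mul, one_mul, zero_mul, Finset.sum_ite_eq',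
    Finset.mem_univ, if_true, MarginalIndex.sum_dualWeight_response, Pi.basisFun_apply,
    Pi.single_apply]
  rw [Fintype.prod_ite_zero]
  simp [funext_iff]

theorem vectorSpan_nonsignaling_le :
    vectorSpan ℝ (nonsignaling X A) ≤ nonsignalingSpace X A := by
  rw [vectorSpan_def, Submodule.span_le]
  rintro _ ⟨P, hP, Q, hQ, rfl⟩
  exact (nonsignalingSpace X A).sub_mem hP.2.2 hQ.2.2

theorem affdim_nonsignaling (hX : ∀ i, 0 < X i) (hA : ∀ i, 0 < A i) :
    (affdim (nonsignaling X A) : ℤ) = (∏ i, ((X i : ℤ) * ((A i : ℤ) - 1) + 1)) - 1 := by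
  let x₀ : ∀ i, Fin (X i) := fun i => ⟨0, hX i⟩
  let o : ∀ i, Fin (A i) := fun i => ⟨0, hA i⟩
  rw [← card_marginalIndex o]
  have hpos : 0 < Fintype.card (∀ i, MarginalIndex X o i) := Fintype.card_pos
  have hlower : Fintype.card (∀ i, MarginalIndex X o i) - 1 ≤ affdim (nonsignaling X A) := by
    rw [← (linearIndependent_deterministicBehavior x₀ o).affineIndependent.finrank_vectorSpan
      (Nat.sub_add_cancel hpos).symm]
    exact Submodule.finrank_mono
      (vectorSpan_mono ℝ (Set.range_subset_iff.2 (deterministicBehavior_mem o)))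
  have hupper : affdim (nonsignaling X A) < Fintype.card (∀ i, MarginalIndex X o i) := by
    refine lt_of_lt_of_le (Submodule.finrank_lt_finrank_of_lt (lt_of_le_of_ne
      vectorSpan_nonsignaling_le fun h => ?_)) (finrank_nonsignalingSpace_le x₀ o)
    -- The total probability vanishes on differences of distributions, but not on distributions.
    have hker : vectorSpan ℝ (nonsignaling X A) ≤ LinearMap.ker (marginal x₀ fun _ => none) := by
      rw [vectorSpan_def, Submodule.span_le]
      rintro _ ⟨P, hP, Q, hQ, rfl⟩
      simp [marginal_none, hP.2.1, hQ.2.1]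
    have hP := deterministicBehavior_mem o fun i => (none : MarginalIndex X o i)
    have hmem : _ ∈ nonsignalingSpace X A := hP.2.2
    rw [← h] at hmem
    have := hker hmem
    rw [LinearMap.mem_ker, marginal_none, hP.2.1] at this
    exact one_ne_zero this
  lia

end Nonsignaling

/-! ### Resampling one coordinate of a product measure -/

section Update

variable {J : Type*} [Fintype J] [DecidableEq J] {Ω : J → Type*} [∀ j, MeasurableSpace (Ω j)]

/-- Overwriting the coordinate `s` by an independent copy does not change the product law. -/
theorem map_update_prod_pi (ρ : ∀ j, Measure (Ω j)) [∀ j, IsProbabilityMeasure (ρ j)] (s : J) :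
    ((ρ s).prod (Measure.pi ρ)).map (fun p => Function.update p.2 s p.1) = Measure.pi ρ := by
  have hmeas : Measurable fun p : Ω s × (∀ j, Ω j) => Function.update p.2 s p.1 :=
    measurable_update'.comp measurable_swap
  refine (Measure.pi_eq fun t ht => ?_).symm
  rw [Measure.map_apply hmeas (MeasurableSet.univ_pi ht)]
  have hpre : (fun p : Ω s × (∀ j, Ω j) => Function.update p.2 s p.1) ⁻¹' Set.univ.pi t =
      t s ×ˢ Set.univ.pi (Function.update t s Set.univ) := by
    ext ⟨ω, l⟩
    simp only [Set.mem_preimage, Set.mem_univ_pi, Set.mem_prod]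
    constructor
    · intro h
      refine ⟨by simpa using h s, fun j => ?_⟩
      rcases eq_or_ne j s with rfl | hj
      · simp
      · simpa [hj] using h j
    · rintro ⟨h0, h⟩ j
      rcases eq_or_ne j s with rfl | hj
      · simpa using h0
      · simpa [hj] using h j
  rw [hpre, Measure.prod_prod, Measure.pi_pi, ← Finset.mul_prod_erase _ _ (Finset.mem_univ s),
    ← Finset.mul_prod_erase Finset.univ (fun j => ρ j (t j)) (Finset.mem_univ s)]
  rw [Function.update_self, measure_univ, one_mul]
  congr 1
  refine Finset.prod_congr rfl fun j hj => ?_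
  rw [Function.update_of_ne (Finset.ne_of_mem_erase hj)]

theorem integral_pi_eq_integral_update (ρ : ∀ j, Measure (Ω j)) [∀ j, IsProbabilityMeasure (ρ j)]
    (s : J) {F : (∀ j, Ω j) → ℝ} (hF : Integrable F (Measure.pi ρ)) :
    ∫ l, F l ∂Measure.pi ρ =
      ∫ ω, ∫ l, F (Function.update l s ω) ∂Measure.pi ρ ∂ρ s := by
  have hmeas : Measurable fun p : Ω s × (∀ j, Ω j) => Function.update p.2 s p.1 :=
    measurable_update'.comp measurable_swap
  have hmap := map_update_prod_pi ρ s
  rw [← hmap] at hF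
  conv_lhs => rw [← hmap, integral_map hmeas.aemeasurable hF.1]
  exact integral_prod _ ((integrable_map_measure hF.1 hmeas.aemeasurable).1 hF)

end Update

/-! ### Marginals on the parties not connected to the source -/

/-- If a linear map is constant on `S ⊆ T` and its image of `T` contains `U`, then the dimensions of
`S` and `U` add up to at most that of `T`. -/
theorem affdim_add_affdim_le {E F : Type*} [AddCommGroup E] [Module ℝ E]
    [FiniteDimensional ℝ E] [AddCommGroup F] [Module ℝ F] (f : E →ₗ[ℝ] F)
    {S T : Set E} {U : Set F} (hST : S ⊆ T) (hS : ∀ x ∈ S, ∀ y ∈ S, f x = f y)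
    (hU : U ⊆ f '' T) : affdim S + affdim U ≤ affdim T := by
  set V := vectorSpan ℝ T
  have hUV : vectorSpan ℝ U ≤ V.map f := by
    rw [vectorSpan_def, Submodule.span_le]
    rintro _ ⟨p, hp, q, hq, rfl⟩
    obtain ⟨x, hx, rfl⟩ := hU hp
    obtain ⟨y, hy, rfl⟩ := hU hq
    exact ⟨x - y, vsub_mem_vectorSpan ℝ hx hy, map_sub f x y⟩
  have hSV : vectorSpan ℝ S ≤ (LinearMap.ker (f.domRestrict V)).map V.subtype := by
    rw [vectorSpan_def, Submodule.span_le]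
    rintro _ ⟨x, hx, y, hy, rfl⟩
    refine ⟨⟨x - y, vsub_mem_vectorSpan ℝ (hST hx) (hST hy)⟩, ?_, rfl⟩
    change f (x - y) = 0
    rw [map_sub, hS x hx y hy, sub_self]
  have h1 : affdim U ≤ Module.finrank ℝ (LinearMap.range (f.domRestrict V)) := by
    rw [LinearMap.range_domRestrict]
    exact Submodule.finrank_mono hUV
  have h2 : affdim S ≤ Module.finrank ℝ (LinearMap.ker (f.domRestrict V)) :=
    (Submodule.finrank_mono hSV).trans (Submodule.finrank_map_le _ _)
  have h3 := LinearMap.finrank_range_add_finrank_ker (f.domRestrict V)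
  change _ ≤ Module.finrank ℝ V
  lia

namespace Network

variable {m n : ℕ} {N : Network m n}

/-- The marginal prescription that keeps the outputs of the parties not connected to `s`. -/
def keep (N : Network m n) (s : Fin n) (a : ∀ i : N.Unconnected s, Fin (N.A i))
    (i : Fin m) : Option (Fin (N.A i)) :=
  if h : N.inc i s = false then some (a ⟨i, h⟩) else none

/-- Extends inputs or outputs of the parties not connected to `s` by reference values. -/
def extend (N : Network m n) (s : Fin n) {κ : Fin m → Type} (o : ∀ i, κ i)
    (a : ∀ i : N.Unconnected s, κ i) (i : Fin m) : κ i :=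
  if h : N.inc i s = false then a ⟨i, h⟩ else o i

/-- The restriction of a behavior to the parties not connected to `s`, the others receiving the
inputs `x₀`. -/
def restrict (N : Network m n) (s : Fin n) (x₀ : ∀ i, Fin (N.X i)) :
    Behavior N.X N.A →ₗ[ℝ]
      Behavior (fun i : N.Unconnected s => N.X i) (fun i : N.Unconnected s => N.A i) :=
  LinearMap.pi fun x => LinearMap.pi fun a => marginal (N.extend s x₀ x) (N.keep s a)

/-- Every nonsignaling distribution over the parties not connected to `s` extends to one over all
parties: let the others answer constantly. -/
theorem exists_restrict_eq (N : Network m n) (s : Fin n) (x₀ : ∀ i, Fin (N.X i))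
    {Q} (hQ : Q ∈ N.nsUnconnected s) : ∃ P ∈ N.nsAll, N.restrict s x₀ P = Q := by
  let o : ∀ i, Fin (N.A i) := fun i => ⟨0, N.A_pos i⟩
  let P : Behavior N.X N.A := fun x a =>
    if ∀ i, N.inc i s ≠ false → a i = o i then
      Q (fun i : N.Unconnected s => x i) (fun i => a i) else 0
  have hres : ∀ {κ : Fin m → Type} (o a), (fun i : N.Unconnected s => N.extend s (κ := κ) o a i) =
      a := by
    intro κ o a
    funext i
    simp [extend, i.2]
  have hinj : Function.Injective (N.extend s o) := fun a b hab => by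
    rw [← hres o a, hab, hres]
  have hP0 : ∀ x a, a ∉ Set.range (N.extend s o) → P x a = 0 := by
    intro x a ha
    refine if_neg fun h => ha ⟨fun i => a i, funext fun i => ?_⟩
    by_cases hi : N.inc i s = false
    · simp [extend, hi]
    · simp [extend, hi, h i hi]
  have hPe : ∀ x a, P x (N.extend s o a) = Q (fun i => x i) a := by
    intro x a
    have h : ∀ i, N.inc i s ≠ false → N.extend s o a i = o i := fun i hi => by
      simp [extend, hi]
    simp only [P, if_pos h, hres]
  refine ⟨P, ⟨fun x a => ?_, fun x => ?_, fun i x xi a => ?_⟩, ?_⟩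
  · simp only [P]
    split_ifs
    exacts [hQ.1 _ _, le_rfl]
  · rw [← hQ.2.1 fun i => x i]
    exact (Fintype.sum_of_injective _ hinj _ _ (hP0 x) fun a => (hPe x a).symm).symm
  · by_cases hi : N.inc i s = false
    · have hup : ∀ {κ : Fin m → Type} (y : ∀ i, κ i) (v : κ i),
          (fun j : N.Unconnected s => Function.update y i v j) =
            Function.update (fun j : N.Unconnected s => y j) ⟨i, hi⟩ v := by
        intro κ y v
        funext j
        by_cases hj : j = ⟨i, hi⟩
        · subst hj; simp
        · rw [Function.update_of_ne hj, Function.update_of_ne fun h => hj (Subtype.ext h)]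
      have hc : ∀ b, (∀ j, N.inc j s ≠ false → Function.update a i b j = o j) ↔
          ∀ j, N.inc j s ≠ false → a j = o j := by
        intro b
        refine forall_congr' fun j => imp_congr_right fun hj => ?_
        rw [Function.update_of_ne (by rintro rfl; exact hj hi)]
      simp only [P, hc, hup]
      split_ifs
      · exact hQ.2.2 ⟨i, hi⟩ _ xi _
      · rfl
    · have hup : (fun j : N.Unconnected s => Function.update x i xi j) =
          fun j : N.Unconnected s => x j := by
        funext j
        rw [Function.update_of_ne]
        intro h
        exact hi (h ▸ j.2)
      simp only [P, hup]
  · funext x a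
    change marginal (N.extend s x₀ x) (N.keep s a) P = Q x a
    rw [marginal_apply, Finset.sum_eq_single (N.extend s o a)]
    · rw [if_pos, hPe, hres]
      intro i
      by_cases hi : N.inc i s = false <;> simp [keep, extend, hi]
    · intro b _ hb
      split_ifs with h
      · refine hP0 _ _ ?_
        rintro ⟨c, rfl⟩
        refine hb (congrArg _ (funext fun i => ?_))
        have := h i
        simp only [keep, extend, i.2, dite_true] at this
        simpa [eq_comm] using this
      · rfl
    · simp

/-! ### The strategies of the parties connected to a source -/

/-- A choice of response functions for all parties, on the sources of the local model `M`, in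
which only the parties connected to the source `s` deviate from `M`. The responses may still be
written as functions of the value of `s`; `Strategy.behavior` pins this value. -/
structure Strategy (M : LocalModel.{u} N) (s : Fin n) where
  resp : ∀ i : Fin m, Fin (N.X i) → (∀ j : {j : Fin n // N.inc i j = true}, M.Ω j) →
    Fin (N.A i) → ℝ
  resp_nonneg : ∀ i x l a, 0 ≤ resp i x l a
  resp_sum : ∀ i x l, ∑ a, resp i x l a = 1
  resp_measurable : ∀ i x a, Measurable (fun l => resp i x l a)
  resp_eq : ∀ i, N.inc i s = false → resp i = M.resp i

namespace Strategy

variable {M : LocalModel.{u} N} {s : Fin n}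

theorem resp_le_one (σ : Strategy M s) (i : Fin m) (x l a) : σ.resp i x l a ≤ 1 := by
  rw [← σ.resp_sum i x l]
  exact Finset.single_le_sum (fun b _ => σ.resp_nonneg i x l b) (Finset.mem_univ a)

/-- The joint probability of the outputs `a` when the sources emit `l`. -/
def weight (σ : Strategy M s) (x : ∀ i, Fin (N.X i)) (a : ∀ i, Fin (N.A i))
    (l : ∀ j, M.Ω j) : ℝ :=
  ∏ i, σ.resp i (x i) (fun j => l j) (a i)

theorem weight_nonneg (σ : Strategy M s) (x a l) : 0 ≤ σ.weight x a l :=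
  Finset.prod_nonneg fun _ _ => σ.resp_nonneg _ _ _ _

theorem weight_le_one (σ : Strategy M s) (x a l) : σ.weight x a l ≤ 1 :=
  Finset.prod_le_one (fun _ _ => σ.resp_nonneg _ _ _ _) fun _ _ => σ.resp_le_one _ _ _ _

theorem norm_weight_le (σ : Strategy M s) (x a l) : ‖σ.weight x a l‖ ≤ 1 := by
  rw [Real.norm_of_nonneg (σ.weight_nonneg x a l)]
  exact σ.weight_le_one x a l

theorem measurable_weight (σ : Strategy M s) (x a) : Measurable (σ.weight x a) :=
  Finset.measurable_prod _ fun i _ => (σ.resp_measurable i (x i) (a i)).comp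
    (measurable_pi_lambda _ fun _ => measurable_pi_apply _)

theorem weight_mem_nonsignaling (σ : Strategy M s) (l) :
    (fun x a => σ.weight x a l : Behavior N.X N.A) ∈ N.nsAll :=
  prod_mem_nonsignaling (fun i x a => σ.resp i x (fun j => l j) a)
    (fun i x a => σ.resp_nonneg i x _ a) fun i x => σ.resp_sum i x _

/-- The behavior when the source `s` constantly emits `ω`. -/
def behavior (σ : Strategy M s) (ω : M.Ω s) : Behavior N.X N.A := fun x a =>
  ∫ l, σ.weight x a (Function.update l s ω) ∂Measure.pi M.ρ

theorem measurable_update_source (ω : M.Ω s) :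
    Measurable fun l : (∀ j, M.Ω j) => Function.update l s ω :=
  measurable_update'.comp (measurable_id.prodMk measurable_const)

theorem integrable_weight (σ : Strategy M s) (ω : M.Ω s) (x a) :
    Integrable (fun l => σ.weight x a (Function.update l s ω)) (Measure.pi M.ρ) :=
  Integrable.of_bound
    ((σ.measurable_weight x a).comp (measurable_update_source ω)).aestronglyMeasurable 1
    (.of_forall fun _ => σ.norm_weight_le _ _ _)

theorem behavior_mem_nsAll (σ : Strategy M s) (ω : M.Ω s) : σ.behavior ω ∈ N.nsAll := by
  refine ⟨fun x a => integral_nonneg fun l => σ.weight_nonneg x a _, fun x => ?_,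
    fun i x xi a => ?_⟩
  · simp only [behavior]
    rw [← integral_finsetSum _ fun a _ => σ.integrable_weight ω x a]
    simp [fun l => (σ.weight_mem_nonsignaling l).2.1 x]
  · simp only [behavior]
    rw [← integral_finsetSum _ fun b _ => σ.integrable_weight ω _ _,
      ← integral_finsetSum _ fun b _ => σ.integrable_weight ω _ _]
    simp only [fun l => (σ.weight_mem_nonsignaling l).2.2 i x xi a]

/-- The parties not connected to `s` do not see the strategy of the others. -/
theorem restrict_behavior_eq (σ τ : Strategy M s) (ω : M.Ω s) (x₀ : ∀ i, Fin (N.X i)) :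
    N.restrict s x₀ (σ.behavior ω) = N.restrict s x₀ (τ.behavior ω) := by
  have key : ∀ (σ : Strategy M s) x (a : ∀ i : N.Unconnected s, Fin (N.A i)),
      marginal x (N.keep s a) (σ.behavior ω) = ∫ l, ∏ i, (if h : N.inc i s = false then
        M.resp i (x i) (fun j => Function.update l s ω j) (a ⟨i, h⟩) else 1)
        ∂Measure.pi M.ρ := by
    intro σ x a
    have hsum : marginal x (N.keep s a) (σ.behavior ω) = ∑ b : (∀ i, Fin (N.A i)),
        ∫ l, (∏ i, if N.keep s a i = none ∨ N.keep s a i = some (b i) then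
          σ.resp i (x i) (fun j => Function.update l s ω j) (b i) else 0) ∂Measure.pi M.ρ := by
      rw [marginal_apply]
      refine Finset.sum_congr rfl fun b _ => ?_
      by_cases h : ∀ i, N.keep s a i = none ∨ N.keep s a i = some (b i)
      · rw [if_pos h]
        simp only [if_pos (h _)]
        rfl
      · rw [if_neg h]
        simp only [Fintype.prod_ite_zero, if_neg h, integral_zero]
    rw [hsum, ← integral_finsetSum]
    -- The responses of the connected parties are summed over and contribute a factor `1`.
    · congr 1
      funext l
      rw [← Fintype.prod_sum (fun i b => if N.keep s a i = none ∨ N.keep s a i = some b then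
            σ.resp i (x i) (fun j => Function.update l s ω j) b else 0)]
      refine Finset.prod_congr rfl fun i _ => ?_
      by_cases h : N.inc i s = false
      · simp [keep, h, σ.resp_eq i h]
      · simp [keep, h, σ.resp_sum]
    · intro b _
      simp only [Fintype.prod_ite_zero]
      split_ifs
      · exact σ.integrable_weight ω x b
      · exact integrable_zero _ _ _
  funext x a
  exact (key σ _ a).trans (key τ _ a).symm

theorem affdim_range_behavior_le (ω : M.Ω s) :
    affdim (Set.range fun σ : Strategy M s => σ.behavior ω) ≤
      affdim N.nsAll - affdim (N.nsUnconnected s) := by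
  let x₀ : ∀ i, Fin (N.X i) := fun i => ⟨0, N.X_pos i⟩
  refine Nat.le_sub_of_add_le (affdim_add_affdim_le (N.restrict s x₀) ?_ ?_ ?_)
  · rintro _ ⟨σ, rfl⟩
    exact σ.behavior_mem_nsAll ω
  · rintro _ ⟨σ, rfl⟩ _ ⟨τ, rfl⟩
    exact restrict_behavior_eq σ τ ω x₀
  · intro Q hQ
    exact N.exists_restrict_eq s x₀ hQ

/-! ### The behaviors of all strategies form a connected set -/

/-- The pointwise mixture of two strategies. -/
def mix (σ τ : Strategy M s) (t : unitInterval) : Strategy M s where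
  resp i x l a := (1 - t) * σ.resp i x l a + t * τ.resp i x l a
  resp_nonneg i x l a := add_nonneg
    (mul_nonneg (sub_nonneg.2 t.2.2) (σ.resp_nonneg i x l a))
    (mul_nonneg t.2.1 (τ.resp_nonneg i x l a))
  resp_sum i x l := by
    rw [Finset.sum_add_distrib, ← Finset.mul_sum, ← Finset.mul_sum, σ.resp_sum, τ.resp_sum]
    ring
  resp_measurable i x a :=
    ((σ.resp_measurable i x a).const_mul _).add ((τ.resp_measurable i x a).const_mul _)
  resp_eq i hi := by
    funext x l a
    rw [σ.resp_eq i hi, τ.resp_eq i hi]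
    ring

theorem continuous_behavior_mix (σ τ : Strategy M s) (ω : M.Ω s) :
    Continuous fun t => (mix σ τ t).behavior ω := by
  refine continuous_pi fun x => continuous_pi fun a => ?_
  refine continuous_of_dominated (bound := fun _ => 1)
    (fun t => ((mix σ τ t).integrable_weight ω x a).1)
    (fun t => .of_forall fun l => (mix σ τ t).norm_weight_le _ _ _) (integrable_const _)
    (.of_forall fun l => ?_)
  refine continuous_finsetProd _ fun i _ => ?_
  simp only [mix]
  fun_prop

theorem isPreconnected_range_behavior (ω : M.Ω s) :
    IsPreconnected (Set.range fun σ : Strategy M s => σ.behavior ω) := by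
  refine isPreconnected_of_forall_pair ?_
  rintro _ ⟨σ, rfl⟩ _ ⟨τ, rfl⟩
  refine ⟨Set.range fun t => (mix σ τ t).behavior ω, ?_, ⟨0, ?_⟩, ⟨1, ?_⟩,
    isPreconnected_range (continuous_behavior_mix σ τ ω)⟩
  · rintro _ ⟨t, rfl⟩
    exact ⟨_, rfl⟩
  · simp [mix]
  · simp [mix]

/-! ### The behavior of a local model as a convex combination of strategies -/

/-- The parties connected to `s` pretend that `s` emitted the value `ω`. -/
def pretend (M : LocalModel.{u} N) (s : Fin n) (ω : M.Ω s) : Strategy M s where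
  resp i x l a := M.resp i x (fun j => if h : j.1 = s then h ▸ ω else l j) a
  resp_nonneg i x l a := M.resp_nonneg _ _ _ _
  resp_sum i x l := M.resp_sum _ _ _
  resp_measurable i x a := by
    refine (M.resp_measurable i x a).comp (measurable_pi_lambda _ fun j => ?_)
    by_cases h : j.1 = s
    · simp only [h, dite_true]
      exact measurable_const
    · simp only [h, dite_false]
      exact measurable_pi_apply _
  resp_eq i hi := by
    funext x l a
    congr 1
    funext j
    rw [dif_neg]
    rintro h
    have := j.2
    rw [h, hi] at this
    exact Bool.false_ne_true this

/-- The strategy in which all parties respond as in `M`. -/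
def ofModel (M : LocalModel.{u} N) (s : Fin n) : Strategy M s where
  resp := M.resp
  resp_nonneg := M.resp_nonneg
  resp_sum := M.resp_sum
  resp_measurable := M.resp_measurable
  resp_eq _ _ := rfl

theorem weight_pretend (M : LocalModel.{u} N) (s : Fin n) (ω ω₀ : M.Ω s) (x a) (l : ∀ j, M.Ω j) :
    (pretend M s ω).weight x a (Function.update l s ω₀) =
      (ofModel M s).weight x a (Function.update l s ω) := by
  refine Finset.prod_congr rfl fun i _ => ?_
  simp only [pretend, ofModel]
  congr 1
  funext j
  by_cases h : j.1 = s
  · obtain ⟨j, hj⟩ := j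
    simp only at h
    subst h
    simp
  · simp [h]

/-- The behavior of `M` is the mean, over the value `ω` of the source `s`, of the behaviors of the
strategies `pretend M s ω`. -/
theorem behavior_mem_convexHull (M : LocalModel.{u} N) (s : Fin n) (ω₀ : M.Ω s) :
    M.behavior ∈ convexHull ℝ (Set.range fun σ : Strategy M s => σ.behavior ω₀) := by
  have hmeas : Measurable fun p : M.Ω s × (∀ j, M.Ω j) => Function.update p.2 s p.1 :=
    measurable_update'.comp measurable_swap
  have hint : ∀ x a, Integrable (fun ω => (pretend M s ω).behavior ω₀ x a) (M.ρ s) := by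
    intro x a
    simp only [behavior, weight_pretend]
    refine Integrable.of_bound ?_ 1 (.of_forall fun ω => ?_)
    · exact (((ofModel M s).measurable_weight x a).comp
        hmeas).stronglyMeasurable.integral_prod_right'.aestronglyMeasurable
    · refine (norm_integral_le_of_norm_le_const
        (.of_forall fun l => (ofModel M s).norm_weight_le x a _)).trans ?_
      simp
  have hint' : ∀ x, Integrable (fun ω => (pretend M s ω).behavior ω₀ x) (M.ρ s) :=
    fun x => Integrable.of_eval (hint x)
  have heq : M.behavior = ∫ ω, (pretend M s ω).behavior ω₀ ∂M.ρ s := by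
    funext x a
    rw [eval_integral hint', eval_integral (hint x)]
    simp only [behavior, weight_pretend]
    refine integral_pi_eq_integral_update M.ρ s (F := (ofModel M s).weight x a) ?_
    exact Integrable.of_bound ((ofModel M s).measurable_weight x a).aestronglyMeasurable 1
      (.of_forall fun l => (ofModel M s).norm_weight_le x a l)
  rw [heq]
  exact (convex_convexHull ℝ _).integral_mem_of_finiteDimensional (Integrable.of_eval hint')
    (.of_forall fun ω => subset_convexHull ℝ _ ⟨_, rfl⟩)

end Strategy

end Network

/-! ### Local models with a finite source -/

namespace Network

variable {m n : ℕ} {N : Network m n}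

/-- The sources of the reduced model. The source `s` emits an element of `Fin c` with weights `w`,
all others are unchanged. `g j` translates the values of the new source to those of the old one,
and `k s` reads off the element of `Fin c`; `g s` is constant and `k j` for `j ≠ s` is arbitrary.
Stating this for each `j` separately avoids dependent casts. -/
theorem exists_source (M : LocalModel.{u} N) (s : Fin n) (l₀ : ∀ j, M.Ω j) {c : ℕ} (k₀ : Fin c)
    (w : Fin c → ℝ) (hw : ∀ κ, 0 ≤ w κ) (hw1 : ∑ κ, w κ = 1) (j : Fin n) :
    ∃ (T : Type u) (_ : MeasurableSpace T) (μ : Measure T) (g : T → M.Ω j) (k : T → Fin c),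
      IsProbabilityMeasure μ ∧ Measurable g ∧ Measurable k ∧
      (j = s → ENat.card T = c ∧ (∀ t, g t = l₀ j) ∧
        ∀ H : Fin c → ℝ, ∫ t, H (k t) ∂μ = ∑ κ, w κ * H κ) ∧
      (j ≠ s → ENat.card T = ENat.card (M.Ω j) ∧ μ.map g = M.ρ j) := by
  by_cases hj : j = s
  · let : MeasurableSpace (ULift.{u} (Fin c)) := ⊤
    have : DiscreteMeasurableSpace (ULift.{u} (Fin c)) := ⟨fun _ => trivial⟩
    refine ⟨ULift.{u} (Fin c), inferInstance,
      ∑ κ, ENNReal.ofReal (w κ) • Measure.dirac (ULift.up κ), fun _ => l₀ j, ULift.down,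
      ⟨?_⟩, measurable_const, measurable_of_finite _, fun _ => ⟨by simp, fun _ => rfl, fun H => ?_⟩,
      fun h => absurd hj h⟩
    · simp only [Measure.finsetSum_apply, Measure.smul_apply, measure_univ, smul_eq_mul, mul_one]
      rw [← ENNReal.ofReal_sum_of_nonneg fun κ _ => hw κ, hw1, ENNReal.ofReal_one]
    · rw [integral_finsetSum_measure fun κ _ => Integrable.smul_measure
        (integrable_dirac (by simp)) ENNReal.ofReal_ne_top]
      refine Finset.sum_congr rfl fun κ _ => ?_
      rw [integral_smul_measure, integral_dirac, ENNReal.toReal_ofReal (hw κ), smul_eq_mul]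
  · exact ⟨M.Ω j, inferInstance, M.ρ j, id, fun _ => k₀, inferInstance, measurable_id,
      measurable_const, fun h => absurd h hj, fun _ => ⟨rfl, Measure.map_id⟩⟩

/-- If the source `s` selects, with probabilities `w`, one of `c` strategies for the parties
connected to it, the resulting local model reproduces the corresponding mixture of behaviors. -/
theorem exists_localModel_of_strategies (M : LocalModel.{u} N) (s : Fin n) (ω₀ : M.Ω s) {c : ℕ}
    (hc : 0 < c) (σ : Fin c → Strategy M s) (w : Fin c → ℝ) (hw : ∀ κ, 0 ≤ w κ)
    (hw1 : ∑ κ, w κ = 1) :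
    ∃ M' : LocalModel.{u} N, M'.behavior = ∑ κ, w κ • (σ κ).behavior ω₀ ∧ M'.card s = c ∧
      ∀ j, j ≠ s → M'.card j = M.card j := by
  have hne : ∀ j, Nonempty (M.Ω j) := fun j => nonempty_of_isProbabilityMeasure (M.ρ j)
  let l₀ : ∀ j, M.Ω j := Function.update (fun j => (hne j).some) s ω₀
  choose T mT μ g k hμ hg hk hs hns using exists_source M s l₀ ⟨0, hc⟩ w hw hw1
  have hgs : ∀ t, g s t = ω₀ := fun t => by simp [(hs s rfl).2.1 t, l₀]
  let M' : LocalModel.{u} N :=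
    { Ω := T
      mΩ := mT
      ρ := μ
      prob := hμ
      resp := fun i x l a =>
        if h : N.inc i s = true then
          (σ (k s (l ⟨s, h⟩))).resp i x (fun j => g j (l j)) a
        else M.resp i x (fun j => g j (l j)) a
      resp_nonneg := fun i x l a => by
        split_ifs
        exacts [(σ _).resp_nonneg _ _ _ _, M.resp_nonneg _ _ _ _]
      resp_sum := fun i x l => by
        split_ifs
        exacts [(σ _).resp_sum _ _ _, M.resp_sum _ _ _]
      resp_measurable := fun i x a => by
        have hG : Measurable fun l : (∀ j : {j : Fin n // N.inc i j = true}, T j) =>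
            fun j : {j : Fin n // N.inc i j = true} => g j (l j) :=
          measurable_pi_lambda _ fun j => (hg j).comp (measurable_pi_apply j)
        by_cases h : N.inc i s = true
        · simp only [h, dite_true]
          have hj : Measurable fun p : Fin c × (∀ j : {j : Fin n // N.inc i j = true}, M.Ω j) =>
              (σ p.1).resp i x p.2 a :=
            measurable_from_prod_countable_right fun κ => (σ κ).resp_measurable i x a
          have hks := (hk s).comp
            (measurable_pi_apply (X := fun j : {j : Fin n // N.inc i j = true} => T j) ⟨s, h⟩)
          exact hj.comp (hks.prodMk hG)
        · simp only [h]
          exact (M.resp_measurable i x a).comp hG }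
  refine ⟨M', ?_, (hs s rfl).1, fun j hj => (hns j hj).1⟩
  have hG : Measurable fun l : (∀ j, T j) => fun j => g j (l j) :=
    measurable_pi_lambda _ fun j => (hg j).comp (measurable_pi_apply j)
  -- The translated values are distributed as in `M` with the source `s` frozen at `ω₀`.
  have hmap : (Measure.pi μ).map (fun l j => g j (l j)) =
      (Measure.pi M.ρ).map fun l => Function.update l s ω₀ := by
    let f : ∀ j, M.Ω j → M.Ω j := fun j ω => if j = s then l₀ j else ω
    have hf : ∀ j, Measurable (f j) := fun j => by
      by_cases hj : j = s
      · simp only [f, hj, if_true]; exact measurable_const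
      · simp only [f, hj, if_false]; exact measurable_id
    have hprob : ∀ j, IsProbabilityMeasure ((μ j).map (g j)) := fun j =>
      Measure.isProbabilityMeasure_map (hg j).aemeasurable
    have hprob' : ∀ j, IsProbabilityMeasure ((M.ρ j).map (f j)) := fun j =>
      Measure.isProbabilityMeasure_map (hf j).aemeasurable
    have hupd : (fun l : (∀ j, M.Ω j) => Function.update l s ω₀) = fun l j => f j (l j) := by
      funext l j
      rcases eq_or_ne j s with rfl | hj
      · simp [f, l₀]
      · simp [f, hj]
    rw [hupd, Measure.pi_map_pi fun j => (hg j).aemeasurable,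
      Measure.pi_map_pi fun j => (hf j).aemeasurable]
    congr 1
    funext j
    by_cases hj : j = s
    · have h1 : g j = fun _ => l₀ j := funext (hs j hj).2.1
      have h2 : f j = fun _ => l₀ j := funext fun ω => if_pos hj
      rw [h1, h2, Measure.map_const, Measure.map_const, measure_univ, measure_univ]
    · have h2 : f j = id := funext fun ω => if_neg hj
      rw [(hns j hj).2, h2, Measure.map_id]
  have hbeh : ∀ κ x a, (σ κ).behavior ω₀ x a =
      ∫ l, (σ κ).weight x a (fun j => g j (l j)) ∂Measure.pi μ := by
    intro κ x a
    have h1 := integral_map (μ := Measure.pi μ) hG.aemeasurable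
      ((σ κ).measurable_weight x a).aestronglyMeasurable
    have h2 := integral_map (μ := Measure.pi M.ρ)
      (Strategy.measurable_update_source ω₀).aemeasurable
      ((σ κ).measurable_weight x a).aestronglyMeasurable
    rw [← h1, hmap, h2]
    rfl
  have hprod : ∀ x a (l : ∀ j, T j), ∏ i, M'.resp i (x i) (fun j => l j) (a i) =
      (σ (k s (l s))).weight x a fun j => g j (l j) := by
    intro x a l
    refine Finset.prod_congr rfl fun i _ => ?_
    by_cases h : N.inc i s = true
    · simp only [M', h, dite_true]
    · have h' : N.inc i s = false := by simpa using h
      simp only [M', (σ _).resp_eq i h', h', Bool.false_eq_true, dite_false]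
  funext x a
  have hint : Integrable (fun l => (σ (k s (l s))).weight x a fun j => g j (l j))
      (Measure.pi μ) := by
    refine Integrable.of_bound (Measurable.aestronglyMeasurable ?_) 1
      (.of_forall fun l => (σ _).norm_weight_le _ _ _)
    have hj : Measurable fun p : Fin c × (∀ j, M.Ω j) => (σ p.1).weight x a p.2 :=
      measurable_from_prod_countable_right fun κ => (σ κ).measurable_weight x a
    exact hj.comp (((hk s).comp (measurable_pi_apply s)).prodMk hG)
  have hupd : ∀ (l : ∀ j, T j) (t : T s), (fun j => g j (Function.update l s t j)) =
      fun j => g j (l j) := by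
    intro l t
    funext j
    rcases eq_or_ne j s with rfl | hj
    · rw [hgs, hgs]
    · rw [Function.update_of_ne hj]
  calc M'.behavior x a
      = ∫ l, (σ (k s (l s))).weight x a (fun j => g j (l j)) ∂Measure.pi μ :=
        integral_congr_ae (.of_forall fun l => hprod x a l)
    _ = ∫ t, (σ (k s t)).behavior ω₀ x a ∂μ s := by
        rw [integral_pi_eq_integral_update μ s hint]
        simp only [Function.update_self, hupd, hbeh]
    _ = ∑ κ, w κ * (σ κ).behavior ω₀ x a :=
        (hs s rfl).2.2 fun κ => (σ κ).behavior ω₀ x a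
    _ = (∑ κ, w κ • (σ κ).behavior ω₀) x a := by
        simp [Finset.sum_apply]

end Network

end

theorem proposition3 {m n : ℕ} (N : Network m n) (s : Fin n) :
    -- affine dimensions of the two nonsignaling sets
    (affdim N.nsAll : ℤ) = (∏ i, ((N.X i : ℤ) * ((N.A i : ℤ) - 1) + 1)) - 1 ∧
    (affdim (N.nsUnconnected s) : ℤ) =
      (∏ i : N.Unconnected s, ((N.X i : ℤ) * ((N.A i : ℤ) - 1) + 1)) - 1 ∧
    -- reduction of the cardinality of the source `s`
    ∀ (P : Behavior N.X N.A) (M : Network.LocalModel.{u} N), M.behavior = P →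
      ∃ M' : Network.LocalModel.{u} N, M'.behavior = P ∧
        M'.card s = (max (affdim N.nsAll - affdim (N.nsUnconnected s)) 1 : ℕ) ∧
        ∀ j, j ≠ s → M'.card j = M.card j := by
  refine ⟨affdim_nonsignaling N.X_pos N.A_pos,
    affdim_nonsignaling (fun i => N.X_pos i) fun i => N.A_pos i, ?_⟩
  rintro P M rfl
  obtain ⟨ω₀⟩ := nonempty_of_isProbabilityMeasure (M.ρ s)
  obtain ⟨z, w, hz, hw, hw1, hP⟩ :=
    (Network.Strategy.isPreconnected_range_behavior ω₀).exists_convex_combination_of_mem_convexHull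
      ((Network.Strategy.affdim_range_behavior_le ω₀).trans (le_max_left _ 1)) (le_max_right _ _)
      (Network.Strategy.behavior_mem_convexHull M s ω₀)
  choose σ hσ using hz
  obtain ⟨M', hM', hs, hcard⟩ := Network.exists_localModel_of_strategies M s ω₀
    (lt_of_lt_of_le one_pos (le_max_right _ _)) σ w hw hw1
  refine ⟨M', ?_, hs, hcard⟩
  rw [hM', ← hP]
  exact Finset.sum_congr rfl fun κ _ => congrArg (w κ • ·) (hσ κ)
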